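/- Fix integers $0<m<n$ and a constant $A>0$. Let $G(n,m)$ be the set of $m$-dimensional linear subspaces of $\mathbb{R}^n$; for $V\in G(n,m)$ let $\pi_V$ be the orthogonal projection onto $V$, and write $C_V=\pi_V(C)$ for $C\subset\mathbb{R}^n$. A set $E\subset G(n,m)$ is $\delta$-separated if $\|\pi_V-\pi_W\|\ge\delta$ (operator norm) for all distinct $V,W\in E$. For bounded $S\subset\mathbb{R}^n$ and $\delta>0$, $N(S,\delta)$ is the least number of closed balls of radius $\delta$ needed to cover $S$. A finite set $C$ in the closed unit ball $B(0,1)\subset\mathbb{R}^n$ is a $(\delta,m)$-set with constant $A$ if $|x-y|\ge\delta$ for all distinct $x,y\in C$ and $$\operatorname{card}\,[B(x,r)\cap C]\le A\left(\frac r\delta\right)^m\qquad\text{for all }x\in\mathbb{R}^n,\ r\ge\delta,$$ where $B(x,r)$ is the closed ball. (1) For every $\delta_0\in(0,1)$ there is a constant $K$, depending only on $n,m,A,\delta_0$, such that the following holds for all $0<\delta\le\delta_0$ and all $\tau>0$. Let $C\subset B(0,1)$ be a $(\delta,m)$-set with constant $A$ and with $N\ge 1$ points, and let $E\subset G(n,m)$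 be a $\delta$-separated set such that $N(C_V,\delta)\le\delta^{\tau}N$ for every $V\in E$. Then $E$ is finite and $$\operatorname{card}E\le K\,\delta^{\tau-(n-m)m}\,\log(1/\delta).$$ (2) For all real $\tau<\beta$ there is a constant $c>0$, depending only on $n,m,A,\beta,\tau$, such that the following holds for all $0<\delta<1$. Let $C\subset B(0,1)$ be a $(\delta,m)$-set with constant $A$ and with $N$ points, and let $E\subset G(n,m)$ be a finite $\delta$-separated set with $\operatorname{card}E\ge\delta^{-\beta}$. Then $$\frac1{\operatorname{card}E}\sum_{V\in E}N(C_V,\delta)\ \ge\ c\,\delta^{(n-m)m-\tau}\,N.$$ -/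

import Mathlib

noncomputable section

/-- The Grassmannian `G(n,m)` of `m`-dimensional linear subspaces of `ℝⁿ`. -/
def Grassmannian (n m : ℕ) : Type :=
  {V : Submodule ℝ (EuclideanSpace ℝ (Fin n)) // Module.finrank ℝ V = m}

namespace Grassmannian

variable {n m : ℕ}

/-- The orthogonal projection `π_V`, as a continuous linear map `ℝⁿ → ℝⁿ` with range `V`. -/
def proj (V : Grassmannian n m) : EuclideanSpace ℝ (Fin n) →L[ℝ] EuclideanSpace ℝ (Fin n) :=
  V.1.starProjection

/-- The projection distance `d_π(V,W) = ‖π_V - π_W‖` (operator norm). -/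
def projDist (V W : Grassmannian n m) : ℝ :=
  ‖V.proj - W.proj‖

/-- A set of subspaces is `δ`-separated if distinct elements have projection distance `≥ δ`. -/
def IsDeltaSeparated (δ : ℝ) (E : Set (Grassmannian n m)) : Prop :=
  ∀ V ∈ E, ∀ W ∈ E, V ≠ W → δ ≤ projDist V W

end Grassmannian

/-- `N(A,δ)`: the least number of closed balls of radius `δ` (with arbitrary centres in `ℝⁿ`)
needed to cover `A ⊆ ℝⁿ`. It is only used for finite sets `A`, for which the extended covering
number is finite. -/
def ballCoveringNumber {n : ℕ} (A : Set (EuclideanSpace ℝ (Fin n))) (δ : ℝ) : ℕ :=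
  (Metric.externalCoveringNumber δ.toNNReal A).toNat

/-- `C` is a `(δ,k)`-set with implicit constant `A`: a finite `δ`-separated subset of the closed
unit ball of `ℝⁿ` with `card (B(x,r) ∩ C) ≤ A (r/δ)^k` for all closed balls of radius `r ≥ δ`. -/
structure IsDeltaSet {n : ℕ} (A δ : ℝ) (k : ℕ) (C : Finset (EuclideanSpace ℝ (Fin n))) :
    Prop where
  subset_unitBall : (C : Set (EuclideanSpace ℝ (Fin n))) ⊆ Metric.closedBall 0 1
  separated : ∀ x ∈ C, ∀ y ∈ C, x ≠ y → δ ≤ dist x y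
  card_ball_le : ∀ (x : EuclideanSpace ℝ (Fin n)) (r : ℝ), δ ≤ r →
    ((Metric.closedBall x r ∩ (C : Set (EuclideanSpace ℝ (Fin n)))).ncard : ℝ) ≤ A * (r / δ) ^ k

end

/-! The argument is double counting of close pairs. If few `δ`-balls cover `C_V`, many pairs of
points of `C` have `2δ`-close projections: by Cauchy–Schwarz over the balls, `N²` is at most `N(C_V,
δ)` times the number of close pairs (`card_sq_le_ballCoveringNumber_mul`).

Conversely, a pair with difference `z` is close only for planes `V` nearly orthogonal to `z`. In
graph coordinates `V` has `(n-m)m` free entries, and near-orthogonality confines the `m` entries of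
one row to windows of width about `δ/‖z‖`. So a `δ`-separated family contains at most about
`δ^(-(n-m)m) (δ/‖z‖)^m` such planes (`card_mul_le_packingConst`). Summing `(δ/‖z‖)^m` over `C` in
dyadic shells gives a logarithm (`IsDeltaSet.sum_div_max_pow_le`).

Comparing the two counts gives (1). A further Cauchy–Schwarz over the planes gives (2), where the
gap between `τ` and `β` absorbs the logarithm. -/

noncomputable section

/-! ### Graph charts with bounded coefficients -/

/-- Graph coordinates of a subspace: `V` is the graph of a linear map, with coefficients bounded by
one, over the coordinate plane selected by the injection `f`. -/
structure IsGraphChart {n m : ℕ} (V : Submodule ℝ (EuclideanSpace ℝ (Fin n)))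
    (f : Fin m → Fin n) (L : Matrix (Fin n) (Fin m) ℝ) : Prop where
  injective : Function.Injective f
  abs_le : ∀ i j, |L i j| ≤ 1
  apply_self : ∀ j k, L (f j) k = if j = k then 1 else 0
  mem_iff : ∀ x, x ∈ V ↔ ∀ i, x i = ∑ j, L i j * x (f j)

/-- Row rank equals column rank, so `m` independent rows can be selected. -/
theorem Matrix.exists_submatrix_det_ne_zero {n m : ℕ} (B : Matrix (Fin n) (Fin m) ℝ)
    (hB : LinearIndependent ℝ B.col) : ∃ f : Fin m → Fin n, (B.submatrix f id).det ≠ 0 := by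
  have hr : Module.finrank ℝ (Submodule.span ℝ (Set.range B.row)) = m := by
    rw [← Matrix.rank_eq_finrank_span_row, Matrix.rank_eq_finrank_span_cols,
      finrank_span_eq_card hB, Fintype.card_fin]
  obtain ⟨g, hg, -, hli⟩ := Submodule.exists_fun_fin_finrank_span_eq ℝ (Set.range B.row)
  choose f hf using hg
  refine ⟨f ∘ Fin.cast hr.symm, ?_⟩
  have : LinearIndependent ℝ (B.submatrix (f ∘ Fin.cast hr.symm) id).row := by
    have he : (B.submatrix (f ∘ Fin.cast hr.symm) id).row = g ∘ Fin.cast hr.symm := by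
      funext i j
      simp [← hf]
    rw [he]
    exact hli.comp (Fin.cast hr.symm) (Fin.cast_injective _)
  rw [Matrix.linearIndependent_rows_iff_isUnit, Matrix.isUnit_iff_isUnit_det] at this
  exact this.ne_zero

/-- A matrix with independent columns can be normalised by a maximal minor. -/
theorem Matrix.exists_normalized {n m : ℕ} (B : Matrix (Fin n) (Fin m) ℝ)
    (hB : LinearIndependent ℝ B.col) :
    ∃ (f : Fin m → Fin n) (L : Matrix (Fin n) (Fin m) ℝ), IsUnit (B.submatrix f id).det ∧
      B = L * B.submatrix f id ∧ ∀ i j, |L i j| ≤ 1 := by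
  obtain ⟨f, -, hf⟩ := Finset.exists_max_image Finset.univ
    (fun f : Fin m → Fin n => |(B.submatrix f id).det|)
    ⟨_, Finset.mem_univ (B.exists_submatrix_det_ne_zero hB).choose⟩
  have h0 : (B.submatrix f id).det ≠ 0 := by
    obtain ⟨g, hg⟩ := B.exists_submatrix_det_ne_zero hB
    exact abs_pos.1 ((abs_pos.2 hg).trans_le (hf g (Finset.mem_univ _)))
  have hu : IsUnit (B.submatrix f id).det := isUnit_iff_ne_zero.2 h0
  have hBL : B = B * (B.submatrix f id)⁻¹ * B.submatrix f id := by
    rw [Matrix.mul_assoc, Matrix.nonsing_inv_mul _ hu, Matrix.mul_one]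
  refine ⟨f, B * (B.submatrix f id)⁻¹, hu, hBL, fun i j => ?_⟩
  set L := B * (B.submatrix f id)⁻¹
  have hrow : B i = ∑ k, L i k • B.submatrix f id k := by
    conv_lhs => rw [hBL]
    funext l
    simp [Matrix.mul_apply]
  -- Cramer's rule: replacing row `j` of the minor by row `i` of `B` multiplies its determinant by
  -- `L i j`. Maximality of the minor then forces `|L i j| ≤ 1`.
  have hdet : (B.submatrix (Function.update f j i) id).det = L i j * (B.submatrix f id).det := by
    rw [← smul_eq_mul, ← Matrix.det_updateRow_sum, ← hrow]
    congr 1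
    ext a b
    by_cases h : a = j
    · subst h; simp
    · simp [h]
  have := hf (Function.update f j i) (Finset.mem_univ _)
  rw [hdet, abs_mul] at this
  exact le_of_mul_le_mul_right (by simpa using this) (abs_pos.2 h0)

theorem exists_isGraphChart {n m : ℕ} (V : Submodule ℝ (EuclideanSpace ℝ (Fin n)))
    (hV : Module.finrank ℝ V = m) : ∃ f L, IsGraphChart (m := m) V f L := by
  let b := Module.finBasisOfFinrankEq ℝ V hV
  let B : Matrix (Fin n) (Fin m) ℝ := fun i j => (b j : EuclideanSpace ℝ (Fin n)) i
  have hmem : ∀ x, x ∈ V ↔ ∃ a : Fin m → ℝ, ∀ i, x i = (B.mulVec a) i := by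
    intro x
    constructor
    · intro hx
      refine ⟨b.repr ⟨x, hx⟩, fun i => ?_⟩
      have := congrArg (fun y : V => (y : EuclideanSpace ℝ (Fin n)) i) (b.sum_repr ⟨x, hx⟩)
      simp only [Submodule.coe_sum, Submodule.coe_smul, PiLp.smul_apply,
        WithLp.ofLp_sum, Finset.sum_apply, smul_eq_mul] at this
      rw [← this]
      simp [Matrix.mulVec, dotProduct, B, mul_comm]
    · rintro ⟨a, ha⟩
      have : x = ((∑ j, a j • b j : V) : EuclideanSpace ℝ (Fin n)) := by
        ext i
        rw [ha]
        simp [Matrix.mulVec, dotProduct, B, mul_comm]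
      rw [this]
      exact Submodule.coe_mem _
  have hB : LinearIndependent ℝ B.col := by
    have h1 := b.linearIndependent.map' V.subtype V.ker_subtype
    exact h1.map' (WithLp.linearEquiv 2 ℝ (Fin n → ℝ)).toLinearMap (LinearEquiv.ker _)
  obtain ⟨f, L, hu, hBL, hle⟩ := B.exists_normalized hB
  have hsub : L.submatrix f id = 1 := by
    have : L.submatrix f id * B.submatrix f id = B.submatrix f id := by
      conv_rhs => rw [hBL]
      rfl
    calc L.submatrix f id = L.submatrix f id * B.submatrix f id * (B.submatrix f id)⁻¹ := by
          rw [Matrix.mul_assoc, Matrix.mul_nonsing_inv _ hu, Matrix.mul_one]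
      _ = 1 := by rw [this, Matrix.mul_nonsing_inv _ hu]
  have hself : ∀ j k, L (f j) k = if j = k then 1 else 0 := fun j k => by
    have := congrFun (congrFun hsub j) k
    simpa [Matrix.one_apply] using this
  refine ⟨f, L, ⟨fun j k hjk => ?_, hle, hself, fun x => ?_⟩⟩
  · by_contra h
    have h1 := hself j k
    rw [hjk, hself] at h1
    simp [h] at h1
  · rw [hmem]
    constructor
    · rintro ⟨a, ha⟩ i
      rw [ha, hBL, ← Matrix.mulVec_mulVec]
      simp only [Matrix.mulVec, dotProduct]
      refine Finset.sum_congr rfl fun j _ => ?_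
      rw [ha]
      rfl
    · intro h
      refine ⟨(B.submatrix f id)⁻¹.mulVec (fun j => x (f j)), fun i => ?_⟩
      conv_rhs => rw [hBL]
      rw [Matrix.mulVec_mulVec, Matrix.mul_assoc, ← hBL, Matrix.mul_nonsing_inv _ hu,
        Matrix.mul_one, h i]
      rfl

/-! ### Projections in graph coordinates -/

theorem EuclideanSpace.norm_le_of_abs_le {n : ℕ} {x : EuclideanSpace ℝ (Fin n)} {c : ℝ}
    (h : ∀ i, |x i| ≤ c) :
    ‖x‖ ≤ n * c := by
  calc ‖x‖ = ‖∑ i, x i • EuclideanSpace.single i (1 : ℝ)‖ := by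
        congr 1
        ext k
        simp [Finset.sum_apply, Pi.single_apply]
    _ ≤ ∑ i, ‖x i • EuclideanSpace.single i (1 : ℝ)‖ := norm_sum_le _ _
    _ ≤ ∑ _i : Fin n, c := Finset.sum_le_sum fun i _ => by simpa [norm_smul] using h i
    _ = n * c := by simp

theorem EuclideanSpace.abs_apply_le {n : ℕ} (x : EuclideanSpace ℝ (Fin n)) (i : Fin n) :
    |x i| ≤ ‖x‖ := by
  simpa using PiLp.norm_apply_le x i

namespace IsGraphChart

variable {n m : ℕ} {V W : Submodule ℝ (EuclideanSpace ℝ (Fin n))} {f : Fin m → Fin n}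
  {L M : Matrix (Fin n) (Fin m) ℝ}

theorem col_mem (h : IsGraphChart V f L) (j : Fin m) :
    (WithLp.toLp 2 (L.col j) : EuclideanSpace ℝ (Fin n)) ∈ V := by
  rw [h.mem_iff]
  intro i
  simp [h.apply_self]

/-- Subspaces with close graph coordinates: each point of one is close to the other. -/
theorem exists_near (hV : IsGraphChart V f L) (hW : IsGraphChart W f M) {ε : ℝ}
    (hε : ∀ i j, |L i j - M i j| ≤ ε) {x : EuclideanSpace ℝ (Fin n)} (hx : x ∈ V) :
    ∃ y ∈ W, ‖x - y‖ ≤ n * (m * ε) * ‖x‖ := by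
  have hs : ∀ i, ∑ k, M (f i) k * x (f k) = x (f i) := fun i => by simp [hW.apply_self]
  refine ⟨WithLp.toLp 2 (fun i => ∑ j, M i j * x (f j)), ?_, ?_⟩
  · rw [hW.mem_iff]
    intro i
    simp only [hs]
  · rw [mul_assoc]
    apply EuclideanSpace.norm_le_of_abs_le
    intro i
    rw [PiLp.sub_apply, (hV.mem_iff x).1 hx i]
    simp only [← Finset.sum_sub_distrib, ← sub_mul]
    calc |∑ j, (L i j - M i j) * x (f j)| ≤ ∑ j, |(L i j - M i j) * x (f j)| :=
          Finset.abs_sum_le_sum_abs _ _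
      _ ≤ ∑ _j : Fin m, ε * ‖x‖ := Finset.sum_le_sum fun j _ => by
          rw [abs_mul]
          exact mul_le_mul (hε i j) (EuclideanSpace.abs_apply_le x _) (abs_nonneg _)
            ((abs_nonneg _).trans (hε i j))
      _ = m * ε * ‖x‖ := by simp [mul_assoc]

/-- With `P`, `Q` the two projections, `P - Q = (P - QP) - (Q - QP)`. The first term is the distance
from points of `V` to `W`; the second is the adjoint of `Q - PQ`, the same quantity with the roles
exchanged. -/
theorem norm_starProjection_sub_le (hV : IsGraphChart V f L) (hW : IsGraphChart W f M) {ε : ℝ}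
    (hε0 : 0 ≤ ε) (hε : ∀ i j, |L i j - M i j| ≤ ε) :
    ‖V.starProjection - W.starProjection‖ ≤ 2 * (n * (m * ε)) := by
  have key : ∀ {V W : Submodule ℝ (EuclideanSpace ℝ (Fin n))} {L M : Matrix (Fin n) (Fin m) ℝ},
      IsGraphChart V f L → IsGraphChart W f M → (∀ i j, |L i j - M i j| ≤ ε) →
      ‖V.starProjection - W.starProjection * V.starProjection‖ ≤ n * (m * ε) := by
    intro V W L M hV hW hε
    refine ContinuousLinearMap.opNorm_le_bound _ (by positivity) fun x => ?_
    obtain ⟨y, hy, hxy⟩ := hV.exists_near hW hε (V.starProjection_apply_mem x)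
    calc ‖V.starProjection x - W.starProjection (V.starProjection x)‖
        ≤ ‖V.starProjection x - y‖ := by
          rw [Submodule.starProjection_minimal]
          exact ciInf_le ⟨0, by rintro _ ⟨w, rfl⟩; positivity⟩ (⟨y, hy⟩ : W)
      _ ≤ n * (m * ε) * ‖V.starProjection x‖ := hxy
      _ ≤ n * (m * ε) * ‖x‖ := by
          gcongr
          exact V.norm_starProjection_apply_le x
  have h1 := key hV hW hε
  have h2 := key hW hV (fun i j => by rw [abs_sub_comm]; exact hε i j)
  rw [← norm_star] at h2
  have hsV : star V.starProjection = V.starProjection := isSelfAdjoint_starProjection V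
  have hsW : star W.starProjection = W.starProjection := isSelfAdjoint_starProjection W
  rw [star_sub, star_mul, hsV, hsW] at h2
  calc ‖V.starProjection - W.starProjection‖
      = ‖(V.starProjection - W.starProjection * V.starProjection)
          - (W.starProjection - W.starProjection * V.starProjection)‖ := by congr 1; abel
    _ ≤ n * (m * ε) + n * (m * ε) := (norm_sub_le _ _).trans (add_le_add h1 h2)
    _ = 2 * (n * (m * ε)) := by ring

/-- If `π_V z` is small then `z` is nearly orthogonal to the columns of the graph matrix. -/
theorem abs_sum_le (hV : IsGraphChart V f L) {z : EuclideanSpace ℝ (Fin n)} {ρ : ℝ}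
    (hz : ‖V.starProjection z‖ ≤ ρ) (j : Fin m) : |∑ i, L i j * z i| ≤ n * ρ := by
  have h1 : ∑ i, L i j * z i = inner ℝ (WithLp.toLp 2 (L.col j)) z := by
    simp [PiLp.inner_apply, mul_comm]
  have h2 : inner ℝ (WithLp.toLp 2 (L.col j)) z
      = inner ℝ (WithLp.toLp 2 (L.col j)) (V.starProjection z) := by
    rw [← Submodule.inner_starProjection_left_eq_right,
      Submodule.starProjection_eq_self_iff.2 (hV.col_mem j)]
  rw [h1, h2]
  refine (abs_real_inner_le_norm _ _).trans (mul_le_mul ?_ hz (norm_nonneg _) (by positivity))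
  simpa using EuclideanSpace.norm_le_of_abs_le (x := WithLp.toLp 2 (L.col j)) (c := 1)
    (fun i => hV.abs_le i j)

end IsGraphChart

/-- If `z` projects to short vectors, then all the graph charts over `f` are confined to a thin slab
in the direction of some coordinate `i₁`. -/
theorem IsGraphChart.exists_slab_coordinate {n m : ℕ} (hmn : m < n) (f : Fin m → Fin n)
    {z : EuclideanSpace ℝ (Fin n)} (hz2 : ‖z‖ ≤ 2) {δ : ℝ} (hδ : 0 < δ) :
    ∃ i₁, i₁ ∉ Set.range f ∧ ∀ (V W : Submodule ℝ (EuclideanSpace ℝ (Fin n)))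
      (L M : Matrix (Fin n) (Fin m) ℝ), IsGraphChart V f L → IsGraphChart W f M →
      ‖V.starProjection z‖ ≤ 2 * δ → ‖W.starProjection z‖ ≤ 2 * δ →
      (∀ i, i ∉ Set.range f → i ≠ i₁ → ∀ j, |L i j - M i j| ≤ δ) →
      ∀ j, |L i₁ j - M i₁ j| * ‖z‖ ≤ 24 * n ^ 3 * δ := by
  classical
  have hn1 : (1 : ℝ) ≤ n := by exact_mod_cast (Nat.zero_le m).trans_lt hmn
  have hne : (Finset.univ.filter fun i => i ∉ Set.range f).Nonempty := by
    by_contra h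
    rw [Finset.not_nonempty_iff_eq_empty, Finset.filter_eq_empty_iff] at h
    have hs : Function.Surjective f := fun i => by simpa using h (Finset.mem_univ i)
    have := Fintype.card_le_of_surjective f hs
    simp at this
    omega
  -- The row to solve for is the one where `z` has its largest coordinate off the chart plane.
  obtain ⟨i₁, hi₁, hmax⟩ := Finset.exists_max_image _ (fun i => |z i|) hne
  simp only [Finset.mem_filter, Finset.mem_univ, true_and] at hi₁ hmax
  refine ⟨i₁, hi₁, fun V W L M hV hW hVz hWz hclose j => ?_⟩
  by_cases hbig : ‖z‖ ≤ 4 * n ^ 2 * |z i₁|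
  · have hclose' : ∀ i, i ≠ i₁ → |L i j - M i j| ≤ δ := fun i hi => by
      by_cases hr : i ∈ Set.range f
      · obtain ⟨k, rfl⟩ := hr
        rw [hV.apply_self, hW.apply_self, sub_self, abs_zero]
        exact hδ.le
      · exact hclose i hr hi j
    -- Both columns are nearly orthogonal to `z`, and outside row `i₁` they differ by at most `δ` in
    -- each entry; so the `i₁` term alone is at most `6nδ`.
    have hsplit : (L i₁ j - M i₁ j) * z i₁ = (∑ i, L i j * z i) - (∑ i, M i j * z i)
        - ∑ i ∈ Finset.univ.erase i₁, (L i j - M i j) * z i := by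
      rw [← Finset.sum_sub_distrib, eq_sub_iff_add_eq,
        Finset.add_sum_erase _ (fun i => (L i j - M i j) * z i) (Finset.mem_univ i₁)]
      simp [sub_mul]
    have hrest : |∑ i ∈ Finset.univ.erase i₁, (L i j - M i j) * z i| ≤ n * (δ * 2) := by
      calc _ ≤ ∑ i ∈ Finset.univ.erase i₁, |(L i j - M i j) * z i| := Finset.abs_sum_le_sum_abs _ _
        _ ≤ ∑ _i ∈ (Finset.univ : Finset (Fin n)).erase i₁, δ * 2 :=
            Finset.sum_le_sum fun i hi => by
              rw [abs_mul]
              exact mul_le_mul (hclose' i (Finset.ne_of_mem_erase hi))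
                ((EuclideanSpace.abs_apply_le z i).trans hz2) (abs_nonneg _) hδ.le
        _ ≤ ∑ _i : Fin n, δ * 2 :=
            Finset.sum_le_sum_of_subset_of_nonneg (Finset.erase_subset _ _)
              fun _ _ _ => by positivity
        _ = n * (δ * 2) := by simp
    have h1 := hV.abs_sum_le hVz j
    have h2 := hW.abs_sum_le hWz j
    have h3 : |L i₁ j - M i₁ j| * |z i₁| ≤ 6 * n * δ := by
      rw [← abs_mul, hsplit]
      refine (abs_sub _ _).trans ?_
      have := abs_sub (∑ i, L i j * z i) (∑ i, M i j * z i)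
      linarith
    calc |L i₁ j - M i₁ j| * ‖z‖ ≤ |L i₁ j - M i₁ j| * (4 * n ^ 2 * |z i₁|) := by gcongr
      _ = 4 * n ^ 2 * (|L i₁ j - M i₁ j| * |z i₁|) := by ring
      _ ≤ 4 * n ^ 2 * (6 * n * δ) := by gcongr
      _ = 24 * n ^ 3 * δ := by ring
  · push Not at hbig
    -- Near-orthogonality recovers the chart coordinates of `z` from the others, so `‖z‖ ≤ 2n²δ +
    -- n²|z i₁|`. Here `n²|z i₁| < ‖z‖/4`, hence `‖z‖ = O(δ)`, and the bound `2` on the difference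
    -- of entries suffices.
    have hcoord : ∀ i, |z i| ≤ n * (2 * δ) + n * |z i₁| := by
      intro i
      by_cases hr : i ∈ Set.range f
      · obtain ⟨k, rfl⟩ := hr
        have hsum : ∑ i, L i k * z i = z (f k) + ∑ i with i ∉ Set.range f, L i k * z i := by
          rw [← Finset.sum_filter_add_sum_filter_not _ (fun i => i ∈ Set.range f)]
          congr 1
          rw [Finset.sum_eq_single (f k)]
          · simp [hV.apply_self]
          · intro b hb hbk
            simp only [Finset.mem_filter, Finset.mem_univ, true_and] at hb
            obtain ⟨l, rfl⟩ := hb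
            rw [hV.apply_self, if_neg (fun h => hbk (by rw [h])), zero_mul]
          · simp
        have hrest : |∑ i with i ∉ Set.range f, L i k * z i| ≤ n * |z i₁| := by
          calc _ ≤ ∑ i with i ∉ Set.range f, |L i k * z i| := Finset.abs_sum_le_sum_abs _ _
            _ ≤ ∑ i with i ∉ Set.range f, |z i₁| := Finset.sum_le_sum fun i hi => by
                rw [abs_mul, ← one_mul |z i₁|]
                exact mul_le_mul (hV.abs_le i k) (hmax i (by simpa using hi)) (abs_nonneg _)
                  zero_le_one
            _ ≤ ∑ _i : Fin n, |z i₁| :=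
                Finset.sum_le_sum_of_subset_of_nonneg (Finset.filter_subset _ _)
                  fun _ _ _ => abs_nonneg _
            _ = n * |z i₁| := by simp
        have h1 := hV.abs_sum_le hVz k
        rw [eq_sub_of_add_eq hsum.symm]
        refine (abs_sub _ _).trans (add_le_add h1 hrest)
      · calc |z i| ≤ 1 * |z i₁| := by rw [one_mul]; exact hmax i hr
          _ ≤ n * |z i₁| := by gcongr
          _ ≤ _ := le_add_of_nonneg_left (by positivity)
    have hzn := EuclideanSpace.norm_le_of_abs_le hcoord
    have hR : ‖z‖ ≤ 3 * n ^ 2 * δ := by nlinarith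
    have hLM : |L i₁ j - M i₁ j| ≤ 2 := by
      refine (abs_sub _ _).trans ?_
      linarith [hV.abs_le i₁ j, hW.abs_le i₁ j]
    calc |L i₁ j - M i₁ j| * ‖z‖ ≤ 2 * (3 * n ^ 2 * δ) := by gcongr
      _ = 6 * (n ^ 2 * 1) * δ := by ring
      _ ≤ 24 * (n ^ 2 * n) * δ := by gcongr; norm_num
      _ = 24 * n ^ 3 * δ := by ring

/-! ### Packing of separated planes nearly orthogonal to a vector -/

theorem abs_floor_sub_floor_le {a b c : ℝ} {T : ℕ} (h : |a - b| ≤ c) (hT : c + 1 ≤ T) :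
    ⌊a⌋ ∈ Finset.Icc (⌊b⌋ - (T : ℤ)) (⌊b⌋ + T) := by
  rw [abs_le] at h
  rw [Finset.mem_Icc]
  have h1 := Int.floor_le a
  have h2 := Int.lt_floor_add_one a
  have h3 := Int.floor_le b
  have h4 := Int.lt_floor_add_one b
  constructor
  · have : (⌊b⌋ : ℝ) - T ≤ ⌊a⌋ := by linarith
    exact_mod_cast this
  · have : (⌊a⌋ : ℝ) ≤ ⌊b⌋ + T := by linarith
    exact_mod_cast this

namespace Grassmannian

variable {n m : ℕ}

/-- Round the free entries to a grid. The rows other than `i₁` take at most `2S + 1` values per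
entry; once they are fixed, the slab estimate leaves `2T + 1` values per entry of row `i₁`. Planes
with identical rounding are too close to be distinct. -/
theorem card_le_of_isGraphChart (hmn : m < n) (f : Fin m → Fin n)
    {z : EuclideanSpace ℝ (Fin n)} (hz0 : 0 < ‖z‖) (hz2 : ‖z‖ ≤ 2) {δ : ℝ} (hδ : 0 < δ)
    (F : Finset (Grassmannian n m)) (hF : IsDeltaSeparated δ (F : Set (Grassmannian n m)))
    (hFz : ∀ V ∈ F, ‖V.proj z‖ ≤ 2 * δ) (L : Grassmannian n m → Matrix (Fin n) (Fin m) ℝ)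
    (hL : ∀ V ∈ F, IsGraphChart V.1 f (L V)) {S T : ℕ} (hS : 4 * n ^ 2 / δ + 1 ≤ S)
    (hT : 96 * n ^ 5 / ‖z‖ + 1 ≤ T) :
    F.card ≤ (2 * T + 1) ^ m * (2 * S + 1) ^ ((n - m - 1) * m) := by
  classical
  rcases F.eq_empty_or_nonempty with rfl | ⟨V₁, hV₁⟩
  · simp
  have hn1 : (1 : ℝ) ≤ n := by exact_mod_cast (Nat.zero_le m).trans_lt hmn
  have hmn' : (m : ℝ) ≤ n := by exact_mod_cast hmn.le
  obtain ⟨i₁, hi₁, hslab⟩ := IsGraphChart.exists_slab_coordinate hmn f hz2 hδ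
  have hinj : Function.Injective f := (hL V₁ hV₁).injective
  -- With this mesh, planes in the same cell are at distance at most `2nmε ≤ δ/2 < δ`.
  set ε : ℝ := δ / (4 * n ^ 2) with hε
  have hε0 : 0 < ε := by positivity
  have hεδ : ε ≤ δ := div_le_self hδ.le (by nlinarith)
  let ι := {i : Fin n // i ∉ Set.range f ∧ i ≠ i₁}
  have hι : Fintype.card ι = n - m - 1 := by
    have h1 : (Finset.univ.image f).card = m := by
      rw [Finset.card_image_of_injective _ hinj, Finset.card_univ, Fintype.card_fin]
    have h2 : i₁ ∉ Finset.univ.image f := by simpa using hi₁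
    have h3 : (insert i₁ (Finset.univ.image f))ᶜ.card = n - (m + 1) := by
      rw [Finset.card_compl, Finset.card_insert_of_notMem h2, h1, Fintype.card_fin]
    rw [Fintype.card_subtype, Nat.sub_sub, ← h3]
    congr 1
    ext i
    simp [and_comm]
  let key : Grassmannian n m → ι × Fin m → ℤ := fun V p => ⌊L V p.1 p.2 / ε⌋
  have hcell : ∀ {a b : ℝ}, ⌊a / ε⌋ = ⌊b / ε⌋ → |a - b| ≤ ε := fun {a b} h => by
    have := Int.abs_sub_lt_one_of_floor_eq_floor h
    rw [← sub_div, abs_div, abs_of_pos hε0, div_lt_one hε0] at this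
    exact this.le
  have himage : (F.image key).card ≤ (2 * S + 1) ^ ((n - m - 1) * m) := by
    calc (F.image key).card
        ≤ (Fintype.piFinset fun _ : ι × Fin m => Finset.Icc (-(S : ℤ)) S).card := by
          apply Finset.card_le_card
          intro k hk
          obtain ⟨V, hV, rfl⟩ := Finset.mem_image.1 hk
          rw [Fintype.mem_piFinset]
          intro p
          have h := abs_floor_sub_floor_le (a := L V p.1 p.2 / ε) (b := 0) (c := 4 * n ^ 2 / δ) ?_ hS
          · simpa using h
          · rw [sub_zero, abs_div, abs_of_pos hε0, div_le_iff₀ hε0]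
            refine ((hL V hV).abs_le _ _).trans (le_of_eq ?_)
            rw [hε]
            field_simp
      _ = _ := by
          rw [Fintype.card_piFinset, Finset.prod_const, Finset.card_univ,
            Fintype.card_prod, hι, Fintype.card_fin, Int.card_Icc]
          congr 1
          omega
  refine (Finset.card_le_mul_card_image (f := key) F ((2 * T + 1) ^ m) fun k hk => ?_).trans
    (Nat.mul_le_mul_left _ himage)
  obtain ⟨V₀, hV₀, rfl⟩ := Finset.mem_image.1 hk
  let g : Grassmannian n m → Fin m → ℤ := fun V j => ⌊L V i₁ j / ε⌋
  have hkey : ∀ {V W}, V ∈ F → W ∈ F → key V = key W →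
      ∀ i, i ∉ Set.range f → i ≠ i₁ → ∀ j, |L V i j - L W i j| ≤ ε := by
    intro V W _ _ h i hi hi' j
    exact hcell (congrFun h (⟨i, hi, hi'⟩, j))
  calc (F.filter fun V => key V = key V₀).card
      ≤ (Fintype.piFinset fun j => Finset.Icc (g V₀ j - (T : ℤ)) (g V₀ j + T)).card := by
        apply Finset.card_le_card_of_injOn g
        · intro V hV
          obtain ⟨hV, hVk⟩ := Finset.mem_filter.1 hV
          rw [Finset.mem_coe, Fintype.mem_piFinset]
          intro j
          refine abs_floor_sub_floor_le ?_ hT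
          have h := hslab V.1 V₀.1 (L V) (L V₀) (hL V hV) (hL V₀ hV₀) (hFz V hV) (hFz V₀ hV₀)
            (fun i hi hi' j => (hkey hV hV₀ hVk i hi hi' j).trans hεδ) j
          rw [← sub_div, abs_div, abs_of_pos hε0, div_le_iff₀ hε0]
          rw [← le_div_iff₀ hz0] at h
          refine h.trans (le_of_eq ?_)
          rw [hε]
          field_simp
          norm_num
        · intro V hV W hW hVW
          obtain ⟨hV, hVk⟩ := Finset.mem_filter.1 hV
          obtain ⟨hW, hWk⟩ := Finset.mem_filter.1 hW
          by_contra hne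
          have hd := hF V hV W hW hne
          have hle : projDist V W ≤ 2 * (n * (m * ε)) := by
            refine (hL V hV).norm_starProjection_sub_le (hL W hW) hε0.le fun i j => ?_
            by_cases hr : i ∈ Set.range f
            · obtain ⟨l, rfl⟩ := hr
              rw [(hL V hV).apply_self, (hL W hW).apply_self, sub_self, abs_zero]
              exact hε0.le
            · by_cases hi : i = i₁
              · subst hi
                exact hcell (congrFun hVW j)
              · exact hkey hV hW (hVk.trans hWk.symm) i hr hi j
          have : 2 * (n * (m * ε)) ≤ δ / 2 := by
            calc 2 * (n * (m * ε)) ≤ 2 * (n * (n * ε)) := by gcongr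
              _ = δ / 2 := by rw [hε]; field_simp; norm_num
          linarith
    _ = (2 * T + 1) ^ m := by
        rw [Fintype.card_piFinset, Finset.prod_congr rfl (g := fun _ => 2 * T + 1)]
        · simp
        · intro j _
          rw [Int.card_Icc]
          omega

/-- The constant in the packing estimate for subspaces nearly orthogonal to a vector. -/
def packingConst (n m : ℕ) : ℝ :=
  n ^ m * ((202 * n ^ 5) ^ m * (13 * n ^ 2) ^ ((n - m - 1) * m))

theorem packingConst_pos (hmn : m < n) : 0 < packingConst n m := by
  have : (0 : ℝ) < n := by exact_mod_cast (Nat.zero_le m).trans_lt hmn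
  unfold packingConst
  positivity

/-- A `δ`-separated family of subspaces, all nearly orthogonal to `z`, is small. -/
theorem card_mul_le_packingConst (hmn : m < n)
    {z : EuclideanSpace ℝ (Fin n)} (hz0 : 0 < ‖z‖) (hz2 : ‖z‖ ≤ 2) {δ : ℝ} (hδ : 0 < δ)
    (hδ1 : δ ≤ 1)
    (F : Finset (Grassmannian n m)) (hF : IsDeltaSeparated δ (F : Set (Grassmannian n m)))
    (hFz : ∀ V ∈ F, ‖V.proj z‖ ≤ 2 * δ) :
    (F.card : ℝ) * (‖z‖ ^ m * δ ^ ((n - m - 1) * m)) ≤ packingConst n m := by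
  classical
  have hn1 : (1 : ℝ) ≤ n := by exact_mod_cast (Nat.zero_le m).trans_lt hmn
  choose f L hfL using fun V : Grassmannian n m => exists_isGraphChart V.1 V.2
  set S := ⌈4 * n ^ 2 / δ + 1⌉₊
  set T := ⌈96 * n ^ 5 / ‖z‖ + 1⌉₊
  -- The factor `n ^ m` counts the possible charts `f`.
  have hcard : F.card ≤ ((2 * T + 1) ^ m * (2 * S + 1) ^ ((n - m - 1) * m)) * n ^ m := by
    refine (Finset.card_le_mul_card_image (f := f) F _ fun φ _ => ?_).trans
      (Nat.mul_le_mul_left _ ((Finset.card_le_univ _).trans_eq (by simp)))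
    refine card_le_of_isGraphChart hmn φ hz0 hz2 hδ _ ?_ ?_ L ?_ (Nat.le_ceil _) (Nat.le_ceil _)
    · exact fun V hV W hW => hF V (Finset.mem_filter.1 hV).1 W (Finset.mem_filter.1 hW).1
    · exact fun V hV => hFz V (Finset.mem_filter.1 hV).1
    · exact fun V hV => (Finset.mem_filter.1 hV).2 ▸ hfL V
  have hSle : (2 * S + 1 : ℝ) * δ ≤ 13 * n ^ 2 := by
    have h1 : (S : ℝ) < 4 * n ^ 2 / δ + 1 + 1 := Nat.ceil_lt_add_one (by positivity)
    have h2 : (S : ℝ) * δ ≤ (4 * n ^ 2 / δ + 1 + 1) * δ := by gcongr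
    have h3 : (4 * n ^ 2 / δ + 1 + 1) * δ = 4 * n ^ 2 + 2 * δ := by field_simp; ring
    nlinarith
  have hTle : (2 * T + 1 : ℝ) * ‖z‖ ≤ 202 * n ^ 5 := by
    have h1 : (T : ℝ) < 96 * n ^ 5 / ‖z‖ + 1 + 1 := Nat.ceil_lt_add_one (by positivity)
    have h2 : (T : ℝ) * ‖z‖ ≤ (96 * n ^ 5 / ‖z‖ + 1 + 1) * ‖z‖ := by gcongr
    have h3 : (96 * n ^ 5 / ‖z‖ + 1 + 1) * ‖z‖ = 96 * n ^ 5 + 2 * ‖z‖ := by field_simp; ring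
    have h4 : (1 : ℝ) ≤ n ^ 5 := one_le_pow₀ hn1
    linarith
  calc (F.card : ℝ) * (‖z‖ ^ m * δ ^ ((n - m - 1) * m))
      ≤ (((2 * T + 1) ^ m * (2 * S + 1) ^ ((n - m - 1) * m)) * n ^ m)
          * (‖z‖ ^ m * δ ^ ((n - m - 1) * m)) := by
        gcongr
        exact_mod_cast hcard
    _ = n ^ m * (((2 * T + 1) * ‖z‖) ^ m * ((2 * S + 1) * δ) ^ ((n - m - 1) * m)) := by
        rw [mul_pow, mul_pow]; ring
    _ ≤ packingConst n m := by unfold packingConst; gcongr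

end Grassmannian

/-! ### Covering numbers and close pairs -/

theorem exists_finset_card_eq_ballCoveringNumber {n : ℕ} {S : Set (EuclideanSpace ℝ (Fin n))}
    (hS : S.Finite) {δ : ℝ} (hδ : 0 ≤ δ) :
    ∃ T : Finset (EuclideanSpace ℝ (Fin n)), T.card = ballCoveringNumber S δ ∧
      ∀ x ∈ S, ∃ t ∈ T, dist x t ≤ δ := by
  have hne : Nonempty {N : Set (EuclideanSpace ℝ (Fin n)) // Metric.IsCover δ.toNNReal S N} :=
    ⟨⟨S, Metric.IsCover.rfl⟩⟩
  have hmem : (⨅ N : {N : Set (EuclideanSpace ℝ (Fin n)) // Metric.IsCover δ.toNNReal S N},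
      N.1.encard) ∈ Set.range _ := csInf_mem (Set.range_nonempty _)
  obtain ⟨⟨N, hN⟩, hNe⟩ := hmem
  have heq : N.encard = Metric.externalCoveringNumber δ.toNNReal S := by
    rw [Metric.externalCoveringNumber, iInf_subtype']
    exact hNe
  have hfin : N.Finite := by
    rw [← Set.encard_lt_top_iff, heq]
    exact (Metric.externalCoveringNumber_le_encard_self S).trans_lt hS.encard_lt_top
  refine ⟨hfin.toFinset, ?_, fun x hx => ?_⟩
  · rw [ballCoveringNumber, ← heq, ← Set.ncard_eq_toFinset_card N hfin, Set.ncard]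
  · obtain ⟨t, ht, hxt⟩ := hN hx
    refine ⟨t, by simpa using ht, ?_⟩
    have h : edist x t ≤ (δ.toNNReal : ENNReal) := hxt
    rw [edist_nndist, ENNReal.coe_le_coe, ← NNReal.coe_le_coe, Real.coe_toNNReal _ hδ] at h
    exact h

/-- Cauchy-Schwarz bound of a covering number from below by the number of close pairs. -/
theorem card_sq_le_ballCoveringNumber_mul {α : Type*} {n : ℕ} (C : Finset α)
    (g : α → EuclideanSpace ℝ (Fin n)) {δ : ℝ} (hδ : 0 ≤ δ) :
    C.card ^ 2 ≤ ballCoveringNumber (g '' C) δ *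
      ((C ×ˢ C).filter fun p => dist (g p.1) (g p.2) ≤ 2 * δ).card := by
  classical
  obtain ⟨T, hT, hcov⟩ :=
    exists_finset_card_eq_ballCoveringNumber (C.finite_toSet.image g) hδ
  have : ∀ x, ∃ t, x ∈ C → t ∈ T ∧ dist (g x) t ≤ δ := fun x => by
    by_cases hx : x ∈ C
    · obtain ⟨t, ht, hxt⟩ := hcov _ (Set.mem_image_of_mem g hx)
      exact ⟨t, fun _ => ⟨ht, hxt⟩⟩
    · exact ⟨0, fun h => absurd h hx⟩
  choose c hc using this
  have hN := Finset.card_eq_sum_card_fiberwise (f := c) (s := C) (t := T) fun x hx => (hc x hx).1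
  rw [hN, ← hT]
  -- The sum of squared fibre sizes counts pairs assigned to the same centre, and these are
  -- `2δ`-close.
  refine sq_sum_le_card_mul_sum_sq.trans (Nat.mul_le_mul_left _ ?_)
  calc ∑ t ∈ T, (C.filter fun x => c x = t).card ^ 2
      = ∑ t ∈ T, (((C ×ˢ C).filter fun p => c p.1 = c p.2).filter fun p => c p.1 = t).card := by
        refine Finset.sum_congr rfl fun t _ => ?_
        rw [sq, ← Finset.card_product]
        congr 1
        ext p
        simp only [Finset.mem_product, Finset.mem_filter]
        constructor
        · rintro ⟨⟨h1, h2⟩, h3, h4⟩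
          exact ⟨⟨⟨h1, h3⟩, h2.trans h4.symm⟩, h2⟩
        · rintro ⟨⟨⟨h1, h3⟩, h4⟩, h2⟩
          exact ⟨⟨h1, h2⟩, h3, h4.symm.trans h2⟩
    _ = ((C ×ˢ C).filter fun p => c p.1 = c p.2).card := by
        refine (Finset.card_eq_sum_card_fiberwise fun p hp => ?_).symm
        exact (hc _ (Finset.mem_product.1 (Finset.mem_filter.1 hp).1).1).1
    _ ≤ _ := by
        refine Finset.card_le_card fun p hp => ?_
        obtain ⟨hp, hcp⟩ := Finset.mem_filter.1 hp
        obtain ⟨h1, h2⟩ := Finset.mem_product.1 hp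
        refine Finset.mem_filter.2 ⟨hp, ?_⟩
        have ha := (hc _ h1).2
        have hb := (hc _ h2).2
        rw [← hcp] at hb
        have := dist_triangle_right (g p.1) (g p.2) (c p.1)
        linarith

/-! ### Discrete energy of a `(δ,m)`-set -/

namespace IsDeltaSet

variable {n m : ℕ} {A δ : ℝ} {C : Finset (EuclideanSpace ℝ (Fin n))}

theorem nonneg_const (hC : IsDeltaSet A δ m C) (hδ : 0 < δ) : 0 ≤ A := by
  have := hC.card_ball_le 0 δ le_rfl
  rw [div_self hδ.ne', one_pow, mul_one] at this
  exact (Nat.cast_nonneg _).trans this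

theorem dist_le_two (hC : IsDeltaSet A δ m C) {x y : EuclideanSpace ℝ (Fin n)} (hx : x ∈ C)
    (hy : y ∈ C) : dist x y ≤ 2 := by
  have h1 := hC.subset_unitBall hx
  have h2 := hC.subset_unitBall hy
  rw [Metric.mem_closedBall] at h1 h2
  linarith [dist_triangle_right x y 0]

/-- The discrete `m`-energy of a `(δ,m)`-set at one of its points is at most logarithmic. -/
theorem sum_div_max_pow_le (hC : IsDeltaSet A δ m C) (hδ : 0 < δ) (hδ1 : δ ≤ 1)
    {x : EuclideanSpace ℝ (Fin n)} (hx : x ∈ C) :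
    ∑ y ∈ C, (δ / max δ (dist x y)) ^ m ≤ A * 2 ^ (m + 1) * (1 + Real.log (1 / δ)) := by
  classical
  have hA := hC.nonneg_const hδ
  -- Dyadic shell index of `y` about `x`; truncating the distance below at `δ` puts `x` itself in
  -- shell `0`.
  let k : EuclideanSpace ℝ (Fin n) → ℕ := fun y => Nat.log 2 ⌊max δ (dist x y) / δ⌋₊
  set J := Nat.log 2 ⌊2 / δ⌋₊
  have hfloor : ∀ y, ⌊max δ (dist x y) / δ⌋₊ ≠ 0 := fun y => by
    rw [← Nat.pos_iff_ne_zero, Nat.floor_pos, le_div_iff₀ hδ, one_mul]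
    exact le_max_left _ _
  have hk1 : ∀ y, (2 : ℝ) ^ k y ≤ max δ (dist x y) / δ := fun y => by
    calc (2 : ℝ) ^ k y ≤ (⌊max δ (dist x y) / δ⌋₊ : ℝ) := by
          exact_mod_cast Nat.pow_log_le_self 2 (hfloor y)
      _ ≤ _ := Nat.floor_le (by positivity)
  have hk2 : ∀ y, max δ (dist x y) / δ < 2 ^ (k y + 1) := fun y => by
    refine (Nat.lt_floor_add_one _).trans_le ?_
    have := Nat.lt_pow_succ_log_self (b := 2) one_lt_two ⌊max δ (dist x y) / δ⌋₊
    exact_mod_cast Nat.succ_le_of_lt this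
  have hkJ : ∀ y ∈ C, k y ∈ Finset.range (J + 1) := fun y hy => by
    rw [Finset.mem_range, Nat.lt_succ_iff]
    refine Nat.log_mono_right (Nat.floor_mono ?_)
    gcongr
    exact max_le (by linarith) (hC.dist_le_two hx hy)
  -- From `2 ^ J ≤ 2 / δ` one gets `J log 2 ≤ log 2 + log (1/δ)`, and `log 2 > 1/2`.
  have hJ : (J : ℝ) + 1 ≤ 2 * (1 + Real.log (1 / δ)) := by
    have h1 : (2 : ℝ) ^ J ≤ 2 / δ := by
      have h0 : ⌊2 / δ⌋₊ ≠ 0 := by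
        rw [← Nat.pos_iff_ne_zero, Nat.floor_pos, le_div_iff₀ hδ]
        linarith
      calc (2 : ℝ) ^ J ≤ (⌊2 / δ⌋₊ : ℝ) := by exact_mod_cast Nat.pow_log_le_self 2 h0
        _ ≤ _ := Nat.floor_le (by positivity)
    have h2 := Real.log_le_log (by positivity) h1
    rw [Real.log_pow, div_eq_mul_one_div, Real.log_mul two_ne_zero (by positivity)] at h2
    have h3 := Real.log_two_gt_d9
    have h4 : 0 ≤ Real.log (1 / δ) := Real.log_nonneg (by rw [le_div_iff₀ hδ]; linarith)
    by_contra! h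
    nlinarith
  calc ∑ y ∈ C, (δ / max δ (dist x y)) ^ m
      = ∑ j ∈ Finset.range (J + 1), ∑ y ∈ C with k y = j, (δ / max δ (dist x y)) ^ m :=
        (Finset.sum_fiberwise_of_maps_to hkJ _).symm
    _ ≤ ∑ _j ∈ Finset.range (J + 1), A * 2 ^ m := by
        refine Finset.sum_le_sum fun j _ => ?_
        -- Shell `j` has at most `A 2^((j+1)m)` points of weight at most `2^(-jm)`, so every shell
        -- contributes at most `A 2^m`.
        calc ∑ y ∈ C with k y = j, (δ / max δ (dist x y)) ^ m
            ≤ ∑ y ∈ C with k y = j, ((2 : ℝ) ^ j)⁻¹ ^ m := by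
              refine Finset.sum_le_sum fun y hy => ?_
              rw [← (Finset.mem_filter.1 hy).2, ← inv_div]
              gcongr
              exact hk1 y
          _ = (C.filter fun y => k y = j).card * ((2 : ℝ) ^ j)⁻¹ ^ m := by simp
          _ ≤ (A * (2 ^ (j + 1)) ^ m) * ((2 : ℝ) ^ j)⁻¹ ^ m := by
              gcongr
              have hball := hC.card_ball_le x (2 ^ (j + 1) * δ)
                (le_mul_of_one_le_left hδ.le (one_le_pow₀ one_le_two))
              rw [mul_div_assoc, div_self hδ.ne', mul_one] at hball
              refine le_trans ?_ hball
              rw [← Set.ncard_coe_finset]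
              refine Nat.cast_le.2 (Set.ncard_le_ncard ?_ (C.finite_toSet.inter_of_right _))
              intro y hy
              obtain ⟨hy, hyj⟩ := Finset.mem_filter.1 hy
              refine ⟨?_, hy⟩
              have := (hk2 y).le
              rw [hyj, div_le_iff₀ hδ] at this
              rw [Metric.mem_closedBall, dist_comm]
              exact (le_max_right _ _).trans this
          _ = A * 2 ^ m := by
              rw [mul_assoc, ← mul_pow, pow_succ]
              congr 2
              field_simp
    _ = (A * 2 ^ m) * ((J : ℝ) + 1) := by simp; ring
    _ ≤ (A * 2 ^ m) * (2 * (1 + Real.log (1 / δ))) := by gcongr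
    _ = _ := by ring

end IsDeltaSet

/-! ### Double counting of close pairs over the planes -/

namespace Grassmannian

variable {n m : ℕ}

/-- The pairs of points of `C` whose projections to `V` are `2δ`-close. -/
def closePairs (C : Finset (EuclideanSpace ℝ (Fin n))) (δ : ℝ) (V : Grassmannian n m) :
    Finset (EuclideanSpace ℝ (Fin n) × EuclideanSpace ℝ (Fin n)) :=
  open Classical in (C ×ˢ C).filter fun p => dist (V.proj p.1) (V.proj p.2) ≤ 2 * δ

/-- The packing estimate is applied to `z = x - y`. When `dist x y ≤ δ`, including `x = y`, any
vector of length `δ` serves instead: all its projections have length at most `δ`. -/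
theorem card_mul_pow_le (hmn : m < n) {δ : ℝ} (hδ : 0 < δ) (hδ1 : δ ≤ 1)
    (F : Finset (Grassmannian n m)) (hF : IsDeltaSeparated δ (F : Set (Grassmannian n m)))
    {x y : EuclideanSpace ℝ (Fin n)} (hxy : dist x y ≤ 2)
    (hFxy : ∀ V ∈ F, dist (V.proj x) (V.proj y) ≤ 2 * δ) :
    (F.card : ℝ) * δ ^ ((n - m) * m) ≤ packingConst n m * (δ / max δ (dist x y)) ^ m := by
  have hpow : δ ^ ((n - m) * m) = δ ^ m * δ ^ ((n - m - 1) * m) := by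
    rw [← pow_add]
    congr 1
    obtain ⟨k, hk⟩ : ∃ k, n - m = k + 1 := ⟨n - m - 1, by omega⟩
    rw [hk, Nat.add_sub_cancel]
    ring
  have key : ∀ z : EuclideanSpace ℝ (Fin n), ‖z‖ = max δ (dist x y) →
      (∀ V ∈ F, ‖V.proj z‖ ≤ 2 * δ) →
      (F.card : ℝ) * δ ^ ((n - m) * m) ≤ packingConst n m * (δ / max δ (dist x y)) ^ m := by
    intro z hz hFz
    have hz0 : 0 < ‖z‖ := hz ▸ lt_max_of_lt_left hδ
    have hz2 : ‖z‖ ≤ 2 := hz ▸ max_le (by linarith) hxy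
    have := card_mul_le_packingConst hmn hz0 hz2 hδ hδ1 F hF hFz
    rw [← hz, div_pow, ← mul_div_assoc, le_div_iff₀ (by positivity), hpow]
    calc _ = δ ^ m * (F.card * (‖z‖ ^ m * δ ^ ((n - m - 1) * m))) := by ring
      _ ≤ δ ^ m * packingConst n m := by gcongr
      _ = _ := mul_comm _ _
  rcases le_total δ (dist x y) with h | h
  · refine key (x - y) (by rw [max_eq_right h, dist_eq_norm]) fun V hV => ?_
    rw [map_sub, ← dist_eq_norm]
    exact hFxy V hV
  · refine key (EuclideanSpace.single ⟨m, hmn⟩ δ) ?_ fun V hV => ?_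
    · rw [max_eq_left h]
      simp [abs_of_pos hδ]
    · refine (V.1.norm_starProjection_apply_le _).trans ?_
      simp only [PiLp.norm_single, Real.norm_eq_abs, abs_of_pos hδ]
      linarith

theorem sum_card_closePairs_mul_le (hmn : m < n) {A δ : ℝ} (hδ : 0 < δ) (hδ1 : δ ≤ 1)
    (F : Finset (Grassmannian n m)) (hF : IsDeltaSeparated δ (F : Set (Grassmannian n m)))
    {C : Finset (EuclideanSpace ℝ (Fin n))} (hC : IsDeltaSet A δ m C) :
    (∑ V ∈ F, ((closePairs C δ V).card : ℝ)) * δ ^ ((n - m) * m) ≤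
      packingConst n m * (A * 2 ^ (m + 1)) * (C.card * (1 + Real.log (1 / δ))) := by
  classical
  have hswap : ∑ V ∈ F, ((closePairs C δ V).card : ℝ) = ∑ x ∈ C, ∑ y ∈ C,
      ((F.filter fun V => dist (V.proj x) (V.proj y) ≤ 2 * δ).card : ℝ) := by
    simp only [closePairs, Finset.card_filter, Nat.cast_sum]
    rw [Finset.sum_comm, Finset.sum_product]
  rw [hswap, Finset.sum_mul]
  calc ∑ x ∈ C, (∑ y ∈ C, ((F.filter fun V => dist (V.proj x) (V.proj y) ≤ 2 * δ).card : ℝ))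
        * δ ^ ((n - m) * m)
      ≤ ∑ x ∈ C, packingConst n m * ∑ y ∈ C, (δ / max δ (dist x y)) ^ m := by
        refine Finset.sum_le_sum fun x hx => ?_
        rw [Finset.sum_mul, Finset.mul_sum]
        refine Finset.sum_le_sum fun y hy => ?_
        refine card_mul_pow_le hmn hδ hδ1 _ ?_ (hC.dist_le_two hx hy) ?_
        · exact fun V hV W hW => hF V (Finset.mem_filter.1 hV).1 W (Finset.mem_filter.1 hW).1
        · exact fun V hV => (Finset.mem_filter.1 hV).2
    _ ≤ ∑ _x ∈ C, packingConst n m * (A * 2 ^ (m + 1) * (1 + Real.log (1 / δ))) := by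
        refine Finset.sum_le_sum fun x hx => ?_
        have := packingConst_pos hmn
        gcongr
        exact hC.sum_div_max_pow_le hδ hδ1 hx
    _ = _ := by simp; ring

theorem card_sq_le_covering_mul_closePairs (C : Finset (EuclideanSpace ℝ (Fin n))) {δ : ℝ}
    (hδ : 0 ≤ δ) (V : Grassmannian n m) :
    (C.card : ℝ) ^ 2 ≤ ballCoveringNumber (V.proj '' C) δ * (closePairs C δ V).card := by
  exact_mod_cast card_sq_le_ballCoveringNumber_mul C V.proj hδ

/-- The constant in the discrete projection theorem. -/
def projectionConst (n m : ℕ) (A : ℝ) : ℝ :=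
  -- The maximum keeps the constant positive for every real `A`.
  packingConst n m * (max A 1 * 2 ^ (m + 1))

theorem projectionConst_pos (hmn : m < n) (A : ℝ) : 0 < projectionConst n m A := by
  have := packingConst_pos hmn
  have : 0 < max A 1 := lt_max_of_lt_right one_pos
  unfold projectionConst
  positivity

theorem sum_card_closePairs_mul_rpow_le (hmn : m < n) {A δ : ℝ} (hδ : 0 < δ) (hδ1 : δ ≤ 1)
    (F : Finset (Grassmannian n m)) (hF : IsDeltaSeparated δ (F : Set (Grassmannian n m)))
    {C : Finset (EuclideanSpace ℝ (Fin n))} (hC : IsDeltaSet A δ m C) :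
    (∑ V ∈ F, ((closePairs C δ V).card : ℝ)) * δ ^ (((n : ℝ) - m) * m) ≤
      projectionConst n m A * (C.card * (1 + Real.log (1 / δ))) := by
  have hD : ((n : ℝ) - m) * m = (((n - m) * m : ℕ) : ℝ) := by
    rw [Nat.cast_mul, Nat.cast_sub hmn.le]
  have hlog : 0 ≤ Real.log (1 / δ) := Real.log_nonneg (by rw [le_div_iff₀ hδ]; linarith)
  have := packingConst_pos hmn
  rw [hD, Real.rpow_natCast]
  refine (sum_card_closePairs_mul_le hmn hδ hδ1 F hF hC).trans ?_
  unfold projectionConst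
  gcongr
  exact le_max_left _ _

/-- A finite set of subspaces with small projections of a `(δ,m)`-set. -/
theorem card_le_of_covering_le (hmn : m < n) {A δ : ℝ} (hδ : 0 < δ) (hδ1 : δ ≤ 1)
    {C : Finset (EuclideanSpace ℝ (Fin n))} (hne : C.Nonempty) (hC : IsDeltaSet A δ m C) {τ : ℝ}
    (F : Finset (Grassmannian n m)) (hF : IsDeltaSeparated δ (F : Set (Grassmannian n m)))
    (hcov : ∀ V ∈ F, (ballCoveringNumber (V.proj '' C) δ : ℝ) ≤ δ ^ τ * C.card) :
    (F.card : ℝ) ≤ projectionConst n m A *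
      (δ ^ (τ - ((n : ℝ) - m) * m) * (1 + Real.log (1 / δ))) := by
  have hN : (0 : ℝ) < C.card := by exact_mod_cast hne.card_pos
  have hP : ∀ V ∈ F, (C.card : ℝ) ≤ δ ^ τ * (closePairs C δ V).card := fun V hV => by
    have h1 := card_sq_le_covering_mul_closePairs C hδ.le V
    have h2 := mul_le_mul_of_nonneg_right (hcov V hV) (Nat.cast_nonneg (closePairs C δ V).card)
    refine le_of_mul_le_mul_left ?_ hN
    linarith
  have hsum : (F.card : ℝ) * C.card ≤ δ ^ τ * ∑ V ∈ F, ((closePairs C δ V).card : ℝ) := by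
    rw [Finset.mul_sum, ← nsmul_eq_mul]
    exact Finset.card_nsmul_le_sum _ _ _ hP
  have hE := sum_card_closePairs_mul_rpow_le hmn hδ hδ1 F hF hC
  have hτ : 0 < δ ^ τ := Real.rpow_pos_of_pos hδ _
  have hD : 0 < δ ^ (((n : ℝ) - m) * m) := Real.rpow_pos_of_pos hδ _
  rw [Real.rpow_sub hδ, div_mul_eq_mul_div, ← mul_div_assoc, le_div_iff₀ hD]
  refine le_of_mul_le_mul_left ?_ hN
  calc C.card * (F.card * δ ^ (((n : ℝ) - m) * m))
      = (F.card * C.card) * δ ^ (((n : ℝ) - m) * m) := by ring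
    _ ≤ (δ ^ τ * ∑ V ∈ F, ((closePairs C δ V).card : ℝ)) * δ ^ (((n : ℝ) - m) * m) := by gcongr
    _ = δ ^ τ * ((∑ V ∈ F, ((closePairs C δ V).card : ℝ)) * δ ^ (((n : ℝ) - m) * m)) := by ring
    _ ≤ δ ^ τ * (projectionConst n m A * (C.card * (1 + Real.log (1 / δ)))) := by gcongr
    _ = _ := by ring

/-- The averaged estimate, with an explicit logarithm. -/
theorem card_sq_mul_le_sum_covering (hmn : m < n) {A δ : ℝ} (hδ : 0 < δ) (hδ1 : δ ≤ 1)
    {C : Finset (EuclideanSpace ℝ (Fin n))} (hne : C.Nonempty) (hC : IsDeltaSet A δ m C)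
    (F : Finset (Grassmannian n m)) (hF : IsDeltaSeparated δ (F : Set (Grassmannian n m))) :
    (F.card : ℝ) ^ 2 * (C.card * δ ^ (((n : ℝ) - m) * m)) ≤
      projectionConst n m A * (1 + Real.log (1 / δ)) *
        ∑ V ∈ F, (ballCoveringNumber (V.proj '' C) δ : ℝ) := by
  have hN : (0 : ℝ) < C.card := by exact_mod_cast hne.card_pos
  -- Cauchy–Schwarz over the planes, applied to the square-root form of the estimate for each single
  -- plane.
  have hCS : ((F.card : ℝ) * C.card) ^ 2 ≤ (∑ V ∈ F, (ballCoveringNumber (V.proj '' C) δ : ℝ)) *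
      ∑ V ∈ F, ((closePairs C δ V).card : ℝ) := by
    have := Finset.sum_sq_le_sum_mul_sum_of_sq_le_mul F (r := fun _ => (C.card : ℝ))
      (f := fun V => (ballCoveringNumber (V.proj '' C) δ : ℝ))
      (g := fun V => ((closePairs C δ V).card : ℝ)) (fun _ _ => Nat.cast_nonneg _)
      (fun _ _ => Nat.cast_nonneg _) (fun V _ => card_sq_le_covering_mul_closePairs C hδ.le V)
    simpa using this
  have hE := sum_card_closePairs_mul_rpow_le hmn hδ hδ1 F hF hC
  have hX : 0 ≤ ∑ V ∈ F, (ballCoveringNumber (V.proj '' C) δ : ℝ) :=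
    Finset.sum_nonneg fun _ _ => Nat.cast_nonneg _
  set X := ∑ V ∈ F, (ballCoveringNumber (V.proj '' C) δ : ℝ)
  set Y := ∑ V ∈ F, ((closePairs C δ V).card : ℝ)
  refine le_of_mul_le_mul_left ?_ hN
  calc C.card * ((F.card : ℝ) ^ 2 * (C.card * δ ^ (((n : ℝ) - m) * m)))
      = ((F.card : ℝ) * C.card) ^ 2 * δ ^ (((n : ℝ) - m) * m) := by ring
    _ ≤ (X * Y) * δ ^ (((n : ℝ) - m) * m) := by gcongr
    _ = X * (Y * δ ^ (((n : ℝ) - m) * m)) := by ring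
    _ ≤ X * (projectionConst n m A * (C.card * (1 + Real.log (1 / δ)))) := by gcongr
    _ = _ := by ring

end Grassmannian

/-! ### Absorbing the logarithm, and the theorem -/

theorem one_add_log_one_div_le {δ s : ℝ} (hδ : 0 < δ) (hδ1 : δ ≤ 1) (hs : 0 < s) :
    1 + Real.log (1 / δ) ≤ (1 + 1 / s) * δ ^ (-s) := by
  have h1 : Real.log (1 / δ) ≤ δ ^ (-s) / s := by
    have := Real.log_le_rpow_div (x := 1 / δ) (by positivity) hs
    rwa [one_div, Real.inv_rpow hδ.le, ← Real.rpow_neg hδ.le, ← one_div] at this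
  have h2 : 1 ≤ δ ^ (-s) := Real.one_le_rpow_of_pos_of_le_one_of_nonpos hδ hδ1 (by linarith)
  calc 1 + Real.log (1 / δ) ≤ δ ^ (-s) + δ ^ (-s) / s := add_le_add h2 h1
    _ = _ := by ring

end

theorem mainTheorem5 (n m : ℕ) (hm : 0 < m) (hmn : m < n) (A : ℝ) :
    -- the discrete projection theorem; the constant depends only on `n, m, A, δ₀`
    (∀ δ₀ : ℝ, 0 < δ₀ → δ₀ < 1 → ∃ K : ℝ, 0 < K ∧
      ∀ δ : ℝ, 0 < δ → δ ≤ δ₀ →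
      ∀ C : Finset (EuclideanSpace ℝ (Fin n)), C.Nonempty → IsDeltaSet A δ m C →
      ∀ τ : ℝ, 0 < τ →
      ∀ E : Set (Grassmannian n m), Grassmannian.IsDeltaSeparated δ E →
        (∀ V ∈ E, (ballCoveringNumber (V.proj '' C) δ : ℝ) ≤ δ ^ τ * (C.card : ℝ)) →
        E.Finite ∧
          (E.ncard : ℝ) ≤ K * (δ ^ (τ - ((n : ℝ) - (m : ℝ)) * (m : ℝ)) * Real.log (1 / δ))) ∧
    -- the averaged form; the constant depends only on `n, m, A, β, τ`
    (∀ β τ : ℝ, τ < β → ∃ c : ℝ, 0 < c ∧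
      ∀ δ : ℝ, 0 < δ → δ < 1 →
      ∀ C : Finset (EuclideanSpace ℝ (Fin n)), IsDeltaSet A δ m C →
      ∀ E : Finset (Grassmannian n m),
        Grassmannian.IsDeltaSeparated δ (E : Set (Grassmannian n m)) →
        δ ^ (-β) ≤ (E.card : ℝ) →
        c * (δ ^ (((n : ℝ) - (m : ℝ)) * (m : ℝ) - τ) * (C.card : ℝ)) ≤
          (1 / (E.card : ℝ)) * ∑ V ∈ E, (ballCoveringNumber (V.proj '' C) δ : ℝ)) := by
  have hQ := Grassmannian.projectionConst_pos hmn A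
  constructor
  · intro δ₀ hδ₀ hδ₀1
    have hlog₀ : 0 < Real.log (1 / δ₀) := Real.log_pos (by rwa [one_lt_div hδ₀])
    refine ⟨Grassmannian.projectionConst n m A * (1 / Real.log (1 / δ₀) + 1), by positivity, ?_⟩
    intro δ hδ hδδ₀ C hne hC τ _ E hE hcov
    have hδ1 : δ ≤ 1 := hδδ₀.trans hδ₀1.le
    -- Since `δ ≤ δ₀ < 1`, the summand `1` is at most `log (1/δ) / log (1/δ₀)`.
    have hlog : 1 + Real.log (1 / δ) ≤ (1 / Real.log (1 / δ₀) + 1) * Real.log (1 / δ) := by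
      have h : Real.log (1 / δ₀) ≤ Real.log (1 / δ) :=
        Real.log_le_log (by positivity) (one_div_le_one_div_of_le hδ hδδ₀)
      rw [add_mul, one_mul, one_div_mul_eq_div]
      gcongr
      rwa [one_le_div hlog₀]
    have hbound : ∀ F : Finset (Grassmannian n m), (F : Set (Grassmannian n m)) ⊆ E →
        (F.card : ℝ) ≤ Grassmannian.projectionConst n m A * (1 / Real.log (1 / δ₀) + 1) *
          (δ ^ (τ - ((n : ℝ) - (m : ℝ)) * (m : ℝ)) * Real.log (1 / δ)) := by
      intro F hFE
      have h := Grassmannian.card_le_of_covering_le hmn hδ hδ1 hne hC F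
        (fun V hV W hW => hE V (hFE hV) W (hFE hW)) (fun V hV => hcov V (hFE hV))
      refine h.trans ?_
      calc _ ≤ Grassmannian.projectionConst n m A * (δ ^ (τ - ((n : ℝ) - (m : ℝ)) * (m : ℝ)) *
              ((1 / Real.log (1 / δ₀) + 1) * Real.log (1 / δ))) := by gcongr
        _ = _ := by ring
    -- The bound is uniform over finite subsets of `E`, so `E` cannot be infinite.
    have hfin : E.Finite := by
      by_contra hinf
      obtain ⟨k, hk⟩ := exists_nat_gt
        (Grassmannian.projectionConst n m A * (1 / Real.log (1 / δ₀) + 1) *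
          (δ ^ (τ - ((n : ℝ) - (m : ℝ)) * (m : ℝ)) * Real.log (1 / δ)))
      obtain ⟨F, hFE, hFk⟩ := Set.Infinite.exists_subset_card_eq hinf k
      have := hbound F hFE
      rw [hFk] at this
      linarith
    refine ⟨hfin, ?_⟩
    rw [Set.ncard_eq_toFinset_card E hfin]
    exact hbound _ (by simp)
  · intro β τ hτβ
    have hs : 0 < β - τ := sub_pos.2 hτβ
    set Q := Grassmannian.projectionConst n m A with hQdef
    refine ⟨1 / (Q * (1 + 1 / (β - τ))), by positivity, ?_⟩
    intro δ hδ hδ1 C hC E hE hcard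
    rcases C.eq_empty_or_nonempty with rfl | hne
    · rw [Finset.card_empty, Nat.cast_zero, mul_zero, mul_zero]
      positivity
    have hEpos : (0 : ℝ) < E.card := (Real.rpow_pos_of_pos hδ _).trans_le hcard
    have hmain := Grassmannian.card_sq_mul_le_sum_covering hmn hδ hδ1.le hne hC E hE
    have hlog := one_add_log_one_div_le hδ hδ1.le hs
    have hX : 0 ≤ ∑ V ∈ E, (ballCoveringNumber (V.proj '' C) δ : ℝ) :=
      Finset.sum_nonneg fun _ _ => Nat.cast_nonneg _
    set X := ∑ V ∈ E, (ballCoveringNumber (V.proj '' C) δ : ℝ)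
    rw [one_div_mul_eq_div, one_div_mul_eq_div, div_le_div_iff₀ (by positivity) hEpos]
    have hδs : 0 < δ ^ (-(β - τ)) := Real.rpow_pos_of_pos hδ _
    refine le_of_mul_le_mul_left ?_ hδs
    -- The logarithm costs `δ ^ (-(β - τ))`; replacing `δ ^ (-β)` by one factor `card E` pays for
    -- it.
    have hexp : δ ^ (-(β - τ)) * δ ^ (((n : ℝ) - m) * m - τ) =
        δ ^ (-β) * δ ^ (((n : ℝ) - m) * m) := by
      rw [← Real.rpow_add hδ, ← Real.rpow_add hδ]
      congr 1
      ring
    calc δ ^ (-(β - τ)) * (δ ^ (((n : ℝ) - m) * m - τ) * C.card * E.card)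
        = (δ ^ (-(β - τ)) * δ ^ (((n : ℝ) - m) * m - τ)) * (C.card * E.card) := by ring
      _ = δ ^ (-β) * (δ ^ (((n : ℝ) - m) * m) * (C.card * E.card)) := by rw [hexp]; ring
      _ ≤ E.card * (δ ^ (((n : ℝ) - m) * m) * (C.card * E.card)) := by gcongr
      _ = (E.card : ℝ) ^ 2 * (C.card * δ ^ (((n : ℝ) - m) * m)) := by ring
      _ ≤ Q * (1 + Real.log (1 / δ)) * X := hmain
      _ ≤ Q * ((1 + 1 / (β - τ)) * δ ^ (-(β - τ))) * X := by gcongr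
      _ = δ ^ (-(β - τ)) * (X * (Q * (1 + 1 / (β - τ)))) := by ring
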